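/- Setting. For each sample size $n$ let $\widehat\beta_C,\widehat\beta_E$ be real estimators, let $\widehat V_C,\widehat V_E,\widehat{\mathrm{cov}}$ be estimators of their variances and covariance (all depending on $n$, and defined on a probability space that may depend on $n$), and let $\beta_0,\beta_E\in\mathbb R$ (possibly depending on $n$). Let $0\le\sigma_E^2<\sigma_C^2$ and assume $$\sqrt n\begin{pmatrix}\widehat\beta_C-\beta_0\\ \widehat\beta_E-\beta_E\end{pmatrix}\xrightarrow{d}\mathcal N\!\left(0,\begin{pmatrix}\sigma_C^2&\sigma_E^2\\ \sigma_E^2&\sigma_E^2\end{pmatrix}\right),\qquad n\widehat V_C\xrightarrow{p}\sigma_C^2,\quad n\widehat V_E\xrightarrow{p}\sigma_E^2,\quad n\,\widehat{\mathrm{cov}}\xrightarrow{p}\sigma_E^2 .$$ Let $\widehat\beta_{MSE}=\widehat p\,\widehat\beta_E+(1-\widehat p)\,\widehat\beta_C$, where $\widehat p$ is a random variable that minimizes over $p\in\mathbb R$ the estimated mean-squared error $$p^2(\widehat\beta_E-\widehat\beta_C)^2+p^2\widehat V_E+(1-p)^2\widehat V_C+2p(1-p)\widehat{\mathrm{cov}}$$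 whenever a minimizer exists ($\widehat p$ is arbitrary on samples where there is none). For $h\in\mathbb R$ let $(V,W_h)$ be a normal vector with means $(0,h)$, variances $(\sigma_C^2,\sigma_C^2-\sigma_E^2)$ and covariance $-(\sigma_C^2-\sigma_E^2)$, and let $$U_h=V+W_h\,\frac{\sigma_C^2-\sigma_E^2}{W_h^2+\sigma_C^2-\sigma_E^2}.$$ Theorem. 1. If $\beta_0\neq\beta_E$ do not depend on $n$, then $\sqrt n(\widehat\beta_{MSE}-\beta_0)\xrightarrow{d}\mathcal N(0,\sigma_C^2)$. 2. If $\beta_E=\beta_0$ (for every $n$), then $\sqrt n(\widehat\beta_{MSE}-\beta_0)\xrightarrow{d}U_0$, where $U_0$ is square integrable, $E(U_0)=0$ and $\mathrm{Var}(U_0)\in(\sigma_E^2,\sigma_C^2)$. 3. If $\beta_E=\beta_0+h/\sqrt n$ for some $h\in\mathbb R$ (for every $n\ge1$), then $\sqrt n(\widehat\beta_{MSE}-\beta_0)\xrightarrow{d}U_h$. Every $U_h$ is square integrable, both maxima below over $h\in\mathbb R$ are attained, and $$\max_{h\in\mathbb R}\left[E(U_h^2)-\sigma_C^2\right]<\max_{h\in\mathbb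 R}\left[\sigma_C^2-E(U_h^2)\right].$$ -/

import Mathlib

open MeasureTheory ProbabilityTheory Filter Topology
open scoped NNReal ENNReal

namespace MSECombination

/-- Convergence in probability of real random variables to a constant, where the `n`-th variable may
live on its own probability space (the data generating process may depend on `n`). -/
def TendstoInProbConst {Ω : ℕ → Type*} {m : ∀ n, MeasurableSpace (Ω n)}
    (P : ∀ n, Measure (Ω n)) (X : ∀ n, Ω n → ℝ) (c : ℝ) : Prop :=
  ∀ ε : ℝ, 0 < ε → Tendsto (fun n => P n {ω | ε ≤ |X n ω - c|}) atTop (𝓝 0)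

/-- The set-up: `bC n`, `bE n` are the consistent and the efficient estimators at sample size `n`,
centred at `β₀ n` and `βE n`; `VC n`, `VE n`, `cv n` are the estimators of their variances and of
their covariance; `vC`, `vE` are the asymptotic variances `σ_C²`, `σ_E²`. -/
structure Setup {Ω : ℕ → Type*} {m : ∀ n, MeasurableSpace (Ω n)}
    (P : ∀ n, Measure (Ω n)) [∀ n, IsProbabilityMeasure (P n)]
    (bC bE VC VE cv : ∀ n, Ω n → ℝ) (β₀ βE : ℕ → ℝ) (vC vE : ℝ≥0) : Prop where
  aemeasurable_VC : ∀ n, AEMeasurable (VC n) (P n)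
  aemeasurable_VE : ∀ n, AEMeasurable (VE n) (P n)
  aemeasurable_cv : ∀ n, AEMeasurable (cv n) (P n)
  asymptotically_normal : TendstoInDistribution
    (fun (n : ℕ) ω => !₂[√(n : ℝ) * (bC n ω - β₀ n), √(n : ℝ) * (bE n ω - βE n)])
    atTop (id : EuclideanSpace ℝ (Fin 2) → EuclideanSpace ℝ (Fin 2)) P
    (multivariateGaussian 0 !![(vC : ℝ), (vE : ℝ); (vE : ℝ), (vE : ℝ)])
  variance_lt : vE < vC
  consistent_VC : TendstoInProbConst P (fun n ω => (n : ℝ) * VC n ω) vC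
  consistent_VE : TendstoInProbConst P (fun n ω => (n : ℝ) * VE n ω) vE
  consistent_cv : TendstoInProbConst P (fun n ω => (n : ℝ) * cv n ω) vE

/-- The estimated mean-squared error of the combination `p * bE + (1 - p) * bC`. -/
def empMSE (bC bE VC VE cv p : ℝ) : ℝ :=
  p ^ 2 * (bE - bC) ^ 2 + p ^ 2 * VE + (1 - p) ^ 2 * VC + 2 * p * (1 - p) * cv

/-- `p` is an empirical-MSE-minimizing weight: it is a random variable at every sample size, and it
minimizes the estimated MSE over `ℝ` whenever the estimated MSE has a minimizer. On samples where
there is no minimizer (the estimated variance of `bE - bC` may be negative) it is arbitrary. -/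
structure IsMSEWeight {Ω : ℕ → Type*} {m : ∀ n, MeasurableSpace (Ω n)}
    (P : ∀ n, Measure (Ω n)) (bC bE VC VE cv p : ∀ n, Ω n → ℝ) : Prop where
  aemeasurable : ∀ n, AEMeasurable (p n) (P n)
  minimizes : ∀ n, ∀ᵐ ω ∂(P n),
    (∃ q : ℝ, ∀ r : ℝ, empMSE (bC n ω) (bE n ω) (VC n ω) (VE n ω) (cv n ω) q ≤
      empMSE (bC n ω) (bE n ω) (VC n ω) (VE n ω) (cv n ω) r) →
    ∀ r : ℝ, empMSE (bC n ω) (bE n ω) (VC n ω) (VE n ω) (cv n ω) (p n ω) ≤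
      empMSE (bC n ω) (bE n ω) (VC n ω) (VE n ω) (cv n ω) r

/-- The weighted sum of the two estimators, with weight `p` on `bE`. -/
def combination (bC bE p : ℝ) : ℝ := p * bE + (1 - p) * bC

/-- The law of the normal vector `(V, W_h)` with means `(0, h)`, variances `(σ_C², σ_C² - σ_E²)`
and covariance `-(σ_C² - σ_E²)`. -/
noncomputable def lawVW (vC vE : ℝ≥0) (h : ℝ) : Measure (EuclideanSpace ℝ (Fin 2)) :=
  multivariateGaussian !₂[0, h]
    !![(vC : ℝ), -((vC : ℝ) - vE); -((vC : ℝ) - vE), (vC : ℝ) - vE]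

instance (vC vE : ℝ≥0) (h : ℝ) : IsProbabilityMeasure (lawVW vC vE h) := by
  unfold lawVW; infer_instance

/-- `V + W (σ_C² - σ_E²) / (W² + σ_C² - σ_E²)` as a function of `(V, W)`; under `lawVW vC vE h`
it is the random variable `U_h`. -/
noncomputable def U (vC vE : ℝ≥0) (x : EuclideanSpace ℝ (Fin 2)) : ℝ :=
  x 0 + x 1 * (((vC : ℝ) - vE) / (x 1 ^ 2 + ((vC : ℝ) - vE)))

/-- `E(U_h²)`. -/
noncomputable def riskU (vC vE : ℝ≥0) (h : ℝ) : ℝ :=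
  ∫ x, U vC vE x ^ 2 ∂(lawVW vC vE h)

end MSECombination

open MSECombination

/-! The estimated MSE is a quadratic in p with leading coefficient Q = (bE - bC)² + VE + VC - 2 cov.
When Q > 0 its only minimizer is (VC - cov)/Q, so the scaled combination error is an explicit
function of the scaled errors, of 1/√n and of the scaled variance estimators. Cutting the
denominator off from below makes this function continuous everywhere, and the cut-off is inactive
with probability tending to one. Slutsky's theorem then gives the limits
(`MSECombination.Setup.tendstoInDistribution`). For fixed distinct limits the correction term is of
order 1/√n and only the error of bC survives; under local alternatives √n(bE - bC) converges to W_h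
and the limit is U_h.

For the risk, put d = σ_C² - σ_E² and write V = Z - (W_h - h) with Z ~ N(0, σ_E²) independent of
W_h. Then U_h is Z plus the error of the shrinkage estimator W - W d/(W² + d) of h, and rescaling by
√d reduces to X - X/(1 + X²) with X ~ N(θ, 1). Stein's identity gives its risk as 1 + k(θ), where
k(θ) = E[(3X² - 2)/(1 + X²)²] is `excessRisk`, hence E(U_h²) = σ_C² + d k(h/√d) (`riskU_eq`).

The pointwise bound 9/20 on the integrand gives k ≤ 9/20, while k(0) lies in (-1, -1/2]. So the
largest loss is at most 9d/20 and the largest gain at least d/2. Both are attained because k is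
continuous, vanishes at infinity and takes both signs. -/

/-! ### Convergence in distribution on varying probability spaces. -/

section Slutsky

variable {Ω : ℕ → Type*} {m : ∀ n, MeasurableSpace (Ω n)} {P : ∀ n, Measure (Ω n)}
  [∀ n, IsProbabilityMeasure (P n)] {Ω' : Type*} {m' : MeasurableSpace Ω'} {μ' : Measure Ω'}
  [IsProbabilityMeasure μ']

/-- Convergence in distribution is a statement about marginal laws, so the variables may be
realized on the product of their probability spaces. -/
lemma tendstoInDistribution_iff_infinitePi {E : Type*} [TopologicalSpace E] [MeasurableSpace E]
    [OpensMeasurableSpace E] {X : ∀ n, Ω n → E} {Z : Ω' → E}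
    (hX : ∀ n, AEMeasurable (X n) (P n)) :
    TendstoInDistribution X atTop Z P μ' ↔
      TendstoInDistribution (fun n (ω : ∀ n, Ω n) => X n (ω n)) atTop Z
        (fun _ => Measure.infinitePi P) μ' := by
  have hmp := fun n => measurePreserving_eval_infinitePi P n
  have hX' : ∀ n, AEMeasurable (fun ω : ∀ n, Ω n => X n (ω n)) (Measure.infinitePi P) :=
    fun n => AEMeasurable.comp_quasiMeasurePreserving (hX n) (hmp n).quasiMeasurePreserving
  have hmap : ∀ n, (Measure.infinitePi P).map (fun ω : ∀ n, Ω n => X n (ω n)) =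
      (P n).map (X n) := by
    intro n
    have h1 : AEMeasurable (X n) ((Measure.infinitePi P).map (Function.eval n)) := by
      rw [(hmp n).map_eq]; exact hX n
    have := AEMeasurable.map_map_of_aemeasurable h1 (hmp n).measurable.aemeasurable
    rw [(hmp n).map_eq] at this
    exact this.symm
  constructor
  · intro h
    refine ⟨hX', h.aemeasurable_limit, ?_⟩
    simpa only [hmap] using h.tendsto
  · intro h
    refine ⟨hX, h.aemeasurable_limit, ?_⟩
    simpa only [hmap] using h.tendsto

/-- The probability of a closed set vanishes asymptotically if the limit avoids it. -/
lemma MeasureTheory.TendstoInDistribution.tendsto_measure_closed {X : ∀ n, Ω n → ℝ} {Z : Ω' → ℝ}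
    (h : TendstoInDistribution X atTop Z P μ') {F : Set ℝ} (hF : IsClosed F)
    (hZ : ∀ ω, Z ω ∉ F) : Tendsto (fun n => P n {ω | X n ω ∈ F}) atTop (𝓝 0) := by
  have h1 := ProbabilityMeasure.limsup_measure_closed_le_of_tendsto h.tendsto hF
  have h2 : (μ'.map Z) F = 0 := by
    rw [Measure.map_apply_of_aemeasurable h.aemeasurable_limit hF.measurableSet]
    convert measure_empty (μ := μ')
    ext ω
    simpa using hZ ω
  have h3 : ∀ n, ((P n).map (X n)) F = P n {ω | X n ω ∈ F} := fun n => by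
    rw [Measure.map_apply_of_aemeasurable (h.forall_aemeasurable n) hF.measurableSet]; rfl
  simp only [ProbabilityMeasure.coe_mk, h2, h3, nonpos_iff_eq_zero] at h1
  exact tendsto_of_le_liminf_of_limsup_le bot_le h1.le

/-- Slutsky's theorem for random variables on varying probability spaces. -/
lemma MeasureTheory.TendstoInDistribution.slutsky {E F G : Type*}
    [NormedAddCommGroup E] [MeasurableSpace E] [BorelSpace E] [SecondCountableTopology E]
    [NormedAddCommGroup F] [MeasurableSpace F] [BorelSpace F] [SecondCountableTopology F]
    [TopologicalSpace G] [MeasurableSpace G] [BorelSpace G]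
    {X : ∀ n, Ω n → E} {Z : Ω' → E} (hX : TendstoInDistribution X atTop Z P μ')
    {Y : ∀ n, Ω n → F} {c : F} (hYm : ∀ n, AEMeasurable (Y n) (P n))
    (hY : ∀ ε : ℝ, 0 < ε → Tendsto (fun n => P n {ω | ε ≤ ‖Y n ω - c‖}) atTop (𝓝 0))
    {g : E × F → G} (hg : Continuous g) :
    TendstoInDistribution (fun n ω => g (X n ω, Y n ω)) atTop (fun ω => g (Z ω, c)) P μ' := by
  have hmp := fun n => measurePreserving_eval_infinitePi P n
  have hXm := hX.forall_aemeasurable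
  have hgm : ∀ n, AEMeasurable (fun ω => g (X n ω, Y n ω)) (P n) :=
    fun n => hg.measurable.comp_aemeasurable ((hXm n).prodMk (hYm n))
  have hYm' : ∀ n, AEMeasurable (fun ω : ∀ n, Ω n => Y n (ω n)) (Measure.infinitePi P) :=
    fun n => AEMeasurable.comp_quasiMeasurePreserving (hYm n) (hmp n).quasiMeasurePreserving
  rw [tendstoInDistribution_iff_infinitePi hgm]
  -- On the product space all samples live together, so Slutsky's theorem on a single space applies.
  refine TendstoInDistribution.continuous_comp_prodMk_of_tendstoInMeasure_const (Y := fun n ω =>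
    Y n (ω n)) hg ((tendstoInDistribution_iff_infinitePi hXm).1 hX) ?_
    hYm'
  rw [tendstoInMeasure_iff_norm]
  intro ε hε
  refine (hY ε hε).congr fun n => ?_
  symm
  refine (hmp n).measure_preimage (s := {ω | ε ≤ ‖Y n ω - c‖}) ?_
  exact nullMeasurableSet_le (by fun_prop) (by have := hYm n; fun_prop)

/-- Variables which agree with probability tending to one have the same limit in distribution. -/
lemma MeasureTheory.TendstoInDistribution.of_eventually_eq {X R : ∀ n, Ω n → ℝ} {Z : Ω' → ℝ}
    (hX : TendstoInDistribution X atTop Z P μ') (hR : ∀ n, AEMeasurable (R n) (P n))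
    {B : ∀ n, Set (Ω n)} (hB : Tendsto (fun n => P n (B n)) atTop (𝓝 0))
    (h : ∀ᶠ n in atTop, ∀ᵐ ω ∂(P n), ω ∉ B n → R n ω = X n ω) :
    TendstoInDistribution R atTop Z P μ' := by
  have hmp := fun n => measurePreserving_eval_infinitePi P n
  have hXm := hX.forall_aemeasurable
  rw [tendstoInDistribution_iff_infinitePi hR]
  refine tendstoInDistribution_of_tendstoInMeasure_sub (X := fun n (ω : ∀ n, Ω n) => X n (ω n)) _ _
    ((tendstoInDistribution_iff_infinitePi hXm).1 hX) ?_
    fun n => AEMeasurable.comp_quasiMeasurePreserving (hR n) (hmp n).quasiMeasurePreserving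
  rw [tendstoInMeasure_iff_norm]
  intro ε hε
  refine tendsto_of_tendsto_of_tendsto_of_le_of_le' tendsto_const_nhds hB
    (Eventually.of_forall fun _ => bot_le) ?_
  filter_upwards [h] with n hn
  have h1 := (hmp n).measure_preimage (s := {ω | ε ≤ ‖R n ω - X n ω‖})
    (nullMeasurableSet_le (by fun_prop) (by have := hR n; have := hXm n; fun_prop))
  refine (le_of_eq ?_).trans ((h1.le).trans (measure_mono_ae ?_))
  · congr 1
    ext ω
    simp
  · filter_upwards [hn] with ω hω hmem
    by_contra hB'
    have h0 : ε ≤ ‖R n ω - X n ω‖ := hmem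
    rw [hω hB', sub_self, norm_zero] at h0
    linarith

/-- Only the law of the limit matters; this moves the limit from the space of the normal errors to
`lawVW` or `gaussianReal`. -/
lemma MeasureTheory.TendstoInDistribution.of_map_eq {E Ω'' : Type*} [TopologicalSpace E]
    [MeasurableSpace E] [OpensMeasurableSpace E] {m'' : MeasurableSpace Ω''} {μ'' : Measure Ω''}
    [IsProbabilityMeasure μ''] {X : ∀ n, Ω n → E} {Z : Ω' → E} {W : Ω'' → E}
    (hX : TendstoInDistribution X atTop Z P μ') (hW : AEMeasurable W μ'')
    (h : μ'.map Z = μ''.map W) : TendstoInDistribution X atTop W P μ'' :=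
  ⟨hX.forall_aemeasurable, hW, by simpa only [h] using hX.tendsto⟩

end Slutsky

/-- Convergence in probability of a random vector from convergence of its coordinates. -/
lemma tendsto_measure_norm_prodMk {Ω : ℕ → Type*} {m : ∀ n, MeasurableSpace (Ω n)}
    {P : ∀ n, Measure (Ω n)} {E F : Type*} [NormedAddCommGroup E] [NormedAddCommGroup F]
    {X : ∀ n, Ω n → E} {Y : ∀ n, Ω n → F} {a : E} {b : F}
    (hX : ∀ ε : ℝ, 0 < ε → Tendsto (fun n => P n {ω | ε ≤ ‖X n ω - a‖}) atTop (𝓝 0))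
    (hY : ∀ ε : ℝ, 0 < ε → Tendsto (fun n => P n {ω | ε ≤ ‖Y n ω - b‖}) atTop (𝓝 0))
    (ε : ℝ) (hε : 0 < ε) :
    Tendsto (fun n => P n {ω | ε ≤ ‖(X n ω, Y n ω) - (a, b)‖}) atTop (𝓝 0) := by
  have h := (hX ε hε).add (hY ε hε)
  rw [add_zero] at h
  refine tendsto_of_tendsto_of_tendsto_of_le_of_le tendsto_const_nhds h (fun _ => bot_le)
    fun n => ?_
  refine le_trans (measure_mono fun ω hω => ?_) (measure_union_le _ _)
  simpa [Prod.norm_def] using hω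

/-! ### Stein's identity and the excess risk of the shrinkage estimator. -/

section Stein

/-- Stein's identity for the unit-variance normal distribution. -/
lemma stein_gaussianReal_one {f f' : ℝ → ℝ} (θ C : ℝ) (hf : ∀ x, HasDerivAt f (f' x) x)
    (hf' : Continuous f') (hb : ∀ x, |f x| ≤ C) (hb' : ∀ x, |f' x| ≤ C) :
    ∫ x, (x - θ) * f x ∂(gaussianReal θ 1) = ∫ x, f' x ∂(gaussianReal θ 1) := by
  have hfc : Continuous f := continuous_iff_continuousAt.2 fun x => (hf x).continuousAt
  have hpdf : ∀ x, HasDerivAt (gaussianPDFReal θ 1) (-(x - θ) * gaussianPDFReal θ 1 x) x := by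
    intro x
    have h1 : HasDerivAt (fun x : ℝ => -(x - θ) ^ 2 / (2 * ((1 : ℝ≥0) : ℝ))) (-(x - θ)) x := by
      have := ((((hasDerivAt_id x).sub_const θ).pow 2).neg).div_const (2 * ((1 : ℝ≥0) : ℝ))
      refine this.congr_deriv ?_
      simp
      ring
    refine ((h1.exp).const_mul ((√(2 * Real.pi * ((1 : ℝ≥0) : ℝ)))⁻¹)).congr_deriv ?_
    rw [gaussianPDFReal]; ring
  have i1 : Integrable (fun x => (x - θ) * f x) (gaussianReal θ 1) := by
    refine Integrable.mul_bdd (c := C) ?_ hfc.aestronglyMeasurable (Eventually.of_forall hb)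
    exact ((memLp_id_gaussianReal 1).integrable le_rfl).sub (integrable_const _)
  have i2 : Integrable f' (gaussianReal θ 1) :=
    Integrable.of_bound hf'.aestronglyMeasurable C (Eventually.of_forall hb')
  have i3 : Integrable f (gaussianReal θ 1) :=
    Integrable.of_bound hfc.aestronglyMeasurable C (Eventually.of_forall hb)
  have tr : ∀ {g : ℝ → ℝ}, Integrable g (gaussianReal θ 1) →
      Integrable (fun x => gaussianPDFReal θ 1 x * g x) := by
    intro g hg
    rw [gaussianReal_of_var_ne_zero _ one_ne_zero,
      integrable_withDensity_iff_integrable_smul' (measurable_gaussianPDF _ _)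
        (Eventually.of_forall fun _ => gaussianPDF_lt_top)] at hg
    simpa [toReal_gaussianPDF] using hg
  -- Integration by parts: the density φ satisfies φ' = -(x - θ)φ, and (φ f)' integrates to zero.
  have key := integral_eq_zero_of_hasDerivAt_of_integrable (f := fun x => gaussianPDFReal θ 1 x * f x)
    (fun x => (hpdf x).mul (hf x)) ?_ (tr i3)
  · have h := integral_sub (tr i2) (tr i1)
    rw [integral_gaussianReal_eq_integral_smul one_ne_zero,
      integral_gaussianReal_eq_integral_smul one_ne_zero]
    simp only [smul_eq_mul]
    have h' : ∫ x, (gaussianPDFReal θ 1 x * f' x - gaussianPDFReal θ 1 x * ((x - θ) * f x)) = 0 := by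
      rw [← key]; congr 1; ext x; ring
    linarith
  · refine ((tr i2).sub (tr i1)).congr (Eventually.of_forall fun x => ?_)
    simp only [Pi.sub_apply]; ring

/-- The excess risk of `X - X / (1 + X²)` as an estimator of the mean of `X ~ N(θ, 1)`, as given by
Stein's unbiased risk estimate. -/
noncomputable def excessRisk (θ : ℝ) : ℝ :=
  ∫ x, (3 * x ^ 2 - 2) / (1 + x ^ 2) ^ 2 ∂(gaussianReal θ 1)

lemma abs_div_one_add_sq_le (x : ℝ) : |x / (1 + x ^ 2)| ≤ 1 := by
  rw [abs_div, abs_of_pos (by positivity : (0 : ℝ) < 1 + x ^ 2), div_le_one (by positivity)]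
  nlinarith [sq_abs x, sq_nonneg (|x| - 1)]

lemma hasDerivAt_div_one_add_sq (x : ℝ) :
    HasDerivAt (fun x : ℝ => x / (1 + x ^ 2)) ((1 - x ^ 2) / (1 + x ^ 2) ^ 2) x := by
  have : (1 + x ^ 2) ≠ 0 := by positivity
  refine ((hasDerivAt_id x).div ((((hasDerivAt_id x).pow 2).const_add 1)) this).congr_deriv ?_
  simp only [id, Pi.pow_apply]
  ring

lemma integrable_inv_one_add_sq_pow (θ : ℝ) (n : ℕ) :
    Integrable (fun x : ℝ => ((1 + x ^ 2)⁻¹) ^ n) (gaussianReal θ 1) := by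
  refine Integrable.of_bound (C := 1) (by fun_prop) (Eventually.of_forall fun x => ?_)
  have h0 : (0 : ℝ) ≤ (1 + x ^ 2)⁻¹ := by positivity
  rw [Real.norm_of_nonneg (by positivity)]
  exact pow_le_one₀ h0 (inv_le_one_of_one_le₀ (by nlinarith [sq_nonneg x]))

/-- With Y = 1/(1 + X²), Stein's identity for x/(1 + x²) reads 1 - E Y = 2 E Y² - E Y, and E Y
cancels. -/
lemma integral_inv_one_add_sq_sq :
    ∫ x : ℝ, ((1 + x ^ 2)⁻¹) ^ 2 ∂(gaussianReal 0 1) = 1 / 2 := by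
  have h := stein_gaussianReal_one (f := fun x => x / (1 + x ^ 2))
    (f' := fun x => 2 * ((1 + x ^ 2)⁻¹) ^ 2 - ((1 + x ^ 2)⁻¹) ^ 1) 0 3 ?_ ?_ ?_ ?_
  · rw [integral_sub ((integrable_inv_one_add_sq_pow 0 2).const_mul 2)
      (integrable_inv_one_add_sq_pow 0 1), integral_const_mul] at h
    have h2 : ∫ x : ℝ, (x - 0) * (x / (1 + x ^ 2)) ∂(gaussianReal 0 1) =
        ∫ x : ℝ, (1 - ((1 + x ^ 2)⁻¹) ^ 1) ∂(gaussianReal 0 1) := by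
      congr 1; ext x
      have : (1 + x ^ 2) ≠ 0 := by positivity
      field_simp; ring
    rw [h2, integral_sub (integrable_const _) (integrable_inv_one_add_sq_pow 0 1)] at h
    simp only [integral_const, probReal_univ, smul_eq_mul, one_mul] at h
    linarith
  · intro x
    refine (hasDerivAt_div_one_add_sq x).congr_deriv ?_
    have : (1 + x ^ 2) ≠ 0 := by positivity
    field_simp; ring
  · have : ∀ x : ℝ, (1 + x ^ 2) ≠ 0 := fun x => by positivity
    fun_prop (disch := exact this _)
  · intro x; linarith [abs_div_one_add_sq_le x]
  · intro x
    have h0 : (0 : ℝ) < (1 + x ^ 2)⁻¹ := by positivity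
    have h1 : (1 + x ^ 2)⁻¹ ≤ 1 := inv_le_one_of_one_le₀ (by nlinarith [sq_nonneg x])
    rw [abs_le]; constructor <;> nlinarith

/-- Stein's identity for x/(1 + x²)² reads E Y - E Y² = 4 E Y³ - 3 E Y². -/
lemma integral_inv_one_add_sq_cube :
    4 * ∫ x : ℝ, ((1 + x ^ 2)⁻¹) ^ 3 ∂(gaussianReal 0 1) =
      1 + ∫ x : ℝ, ((1 + x ^ 2)⁻¹) ^ 1 ∂(gaussianReal 0 1) := by
  have h := stein_gaussianReal_one (f := fun x => x / (1 + x ^ 2) ^ 2)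
    (f' := fun x => 4 * ((1 + x ^ 2)⁻¹) ^ 3 - 3 * ((1 + x ^ 2)⁻¹) ^ 2) 0 7 ?_ ?_ ?_ ?_
  · rw [integral_sub ((integrable_inv_one_add_sq_pow 0 3).const_mul 4)
      ((integrable_inv_one_add_sq_pow 0 2).const_mul 3), integral_const_mul,
      integral_const_mul] at h
    have h2 : ∫ x : ℝ, (x - 0) * (x / (1 + x ^ 2) ^ 2) ∂(gaussianReal 0 1) =
        ∫ x : ℝ, (((1 + x ^ 2)⁻¹) ^ 1 - ((1 + x ^ 2)⁻¹) ^ 2) ∂(gaussianReal 0 1) := by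
      congr 1; ext x
      have : (1 + x ^ 2) ≠ 0 := by positivity
      field_simp; ring
    rw [h2, integral_sub (integrable_inv_one_add_sq_pow 0 1)
      (integrable_inv_one_add_sq_pow 0 2)] at h
    linarith [integral_inv_one_add_sq_sq]
  · intro x
    have h1 : (1 + x ^ 2) ≠ 0 := by positivity
    refine ((hasDerivAt_id x).div (((((hasDerivAt_id x).pow 2).const_add 1)).pow 2)
      (pow_ne_zero 2 h1)).congr_deriv ?_
    simp only [id, Pi.pow_apply]
    field_simp; ring
  · have : ∀ x : ℝ, (1 + x ^ 2) ≠ 0 := fun x => by positivity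
    fun_prop (disch := exact this _)
  · intro x
    have h1 : (1 : ℝ) ≤ 1 + x ^ 2 := by nlinarith [sq_nonneg x]
    have h2 : x / (1 + x ^ 2) ^ 2 = x / (1 + x ^ 2) / (1 + x ^ 2) := by rw [div_div, sq]
    rw [h2, abs_div, abs_of_pos (by positivity : (0 : ℝ) < 1 + x ^ 2)]
    linarith [div_le_self (abs_nonneg (x / (1 + x ^ 2))) h1, abs_div_one_add_sq_le x]
  · intro x
    have h0 : (0 : ℝ) < (1 + x ^ 2)⁻¹ := by positivity
    have h1 : (1 + x ^ 2)⁻¹ ≤ 1 := inv_le_one_of_one_le₀ (by nlinarith [sq_nonneg x])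
    have h2 : ((1 + x ^ 2)⁻¹) ^ 2 ≤ 1 := pow_le_one₀ h0.le h1
    have h3 : ((1 + x ^ 2)⁻¹) ^ 3 ≤ 1 := pow_le_one₀ h0.le h1
    have h4 : (0 : ℝ) < ((1 + x ^ 2)⁻¹) ^ 2 := by positivity
    have h5 : (0 : ℝ) < ((1 + x ^ 2)⁻¹) ^ 3 := by positivity
    rw [abs_le]; constructor <;> linarith

/-- The integrand is 3Y - 5Y², so k(0) = 3 E Y - 5/2. Nonnegative cubics in Y confine E Y to [3/5,
2/3], since E Y² and E Y³ are known in terms of E Y. -/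
lemma excessRisk_zero_mem : excessRisk 0 ∈ Set.Ioc (-1 : ℝ) (-1 / 2) := by
  have i1 := integrable_inv_one_add_sq_pow 0 1
  have i2 := integrable_inv_one_add_sq_pow 0 2
  have i3 := integrable_inv_one_add_sq_pow 0 3
  have e2 := integral_inv_one_add_sq_sq
  have e3 := integral_inv_one_add_sq_cube
  have hk : excessRisk 0 = 3 * (∫ x : ℝ, ((1 + x ^ 2)⁻¹) ^ 1 ∂(gaussianReal 0 1)) - 5 / 2 := by
    have : excessRisk 0 =
        ∫ x : ℝ, (3 * ((1 + x ^ 2)⁻¹) ^ 1 - 5 * ((1 + x ^ 2)⁻¹) ^ 2) ∂(gaussianReal 0 1) := by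
      unfold excessRisk
      congr 1; ext x
      have : (1 + x ^ 2) ≠ 0 := by positivity
      field_simp; ring
    rw [this, integral_sub (i1.const_mul 3) (i2.const_mul 5), integral_const_mul,
      integral_const_mul, e2]
    ring
  -- The integrand is (1 - Y)(1 - 2Y)²; this yields E Y ≤ 2/3.
  have upper : 0 ≤ ∫ x : ℝ, (1 - 5 * ((1 + x ^ 2)⁻¹) ^ 1 + 8 * ((1 + x ^ 2)⁻¹) ^ 2
      - 4 * ((1 + x ^ 2)⁻¹) ^ 3) ∂(gaussianReal 0 1) := by
    refine integral_nonneg fun x => ?_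
    have h1 : (1 + x ^ 2)⁻¹ ≤ 1 := inv_le_one_of_one_le₀ (by nlinarith [sq_nonneg x])
    have := mul_nonneg (sub_nonneg.2 h1) (sq_nonneg (1 - 2 * (1 + x ^ 2)⁻¹))
    simp only [Pi.zero_apply]
    linarith
  -- The integrand is Y(1 - Y)²; this yields E Y ≥ 3/5.
  have lower : 0 ≤ ∫ x : ℝ, (((1 + x ^ 2)⁻¹) ^ 1 - 2 * ((1 + x ^ 2)⁻¹) ^ 2
      + ((1 + x ^ 2)⁻¹) ^ 3) ∂(gaussianReal 0 1) := by
    refine integral_nonneg fun x => ?_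
    have h0 : (0 : ℝ) ≤ (1 + x ^ 2)⁻¹ := by positivity
    have := mul_nonneg h0 (sq_nonneg (1 - (1 + x ^ 2)⁻¹))
    simp only [Pi.zero_apply]
    linarith
  have j1 : Integrable (fun x : ℝ => 1 - 5 * ((1 + x ^ 2)⁻¹) ^ 1) (gaussianReal 0 1) :=
    (integrable_const _).sub (i1.const_mul 5)
  have j2 : Integrable (fun x : ℝ => 1 - 5 * ((1 + x ^ 2)⁻¹) ^ 1 + 8 * ((1 + x ^ 2)⁻¹) ^ 2)
      (gaussianReal 0 1) := j1.add (i2.const_mul 8)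
  have j3 : Integrable (fun x : ℝ => ((1 + x ^ 2)⁻¹) ^ 1 - 2 * ((1 + x ^ 2)⁻¹) ^ 2)
      (gaussianReal 0 1) := i1.sub (i2.const_mul 2)
  rw [integral_sub j2 (i3.const_mul 4), integral_add j1 (i2.const_mul 8),
    integral_sub (integrable_const _) (i1.const_mul 5), integral_const_mul, integral_const_mul,
    integral_const_mul, e2, e3] at upper
  rw [integral_add j3 i3, integral_sub i1 (i2.const_mul 2),
    integral_const_mul, e2] at lower
  simp only [integral_const, probReal_univ, smul_eq_mul, one_mul] at upper
  rw [hk]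
  constructor <;> linarith

lemma abs_excess_integrand_le (x : ℝ) : |(3 * x ^ 2 - 2) / (1 + x ^ 2) ^ 2| ≤ 2 := by
  rw [abs_le, le_div_iff₀ (by positivity), div_le_iff₀ (by positivity)]
  constructor <;> nlinarith [sq_nonneg x, sq_nonneg (x ^ 2), sq_nonneg (x ^ 2 - 1)]

lemma continuous_excess_integrand :
    Continuous fun x : ℝ => (3 * x ^ 2 - 2) / (1 + x ^ 2) ^ 2 := by
  have : ∀ x : ℝ, (1 + x ^ 2) ^ 2 ≠ 0 := fun x => by positivity
  fun_prop (disch := exact this _)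

lemma integrable_excess_integrand (θ : ℝ) :
    Integrable (fun x : ℝ => (3 * x ^ 2 - 2) / (1 + x ^ 2) ^ 2) (gaussianReal θ 1) :=
  Integrable.of_bound continuous_excess_integrand.aestronglyMeasurable 2
    (Eventually.of_forall abs_excess_integrand_le)

/-- The integrand has maximum 9/20, at x² = 7/3, whence the square (3x² - 7)². -/
lemma excessRisk_le (θ : ℝ) : excessRisk θ ≤ 9 / 20 := by
  have h : excessRisk θ ≤ ∫ _, (9 / 20 : ℝ) ∂(gaussianReal θ 1) := by
    refine integral_mono (integrable_excess_integrand θ) (integrable_const _) fun x => ?_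
    simp only
    rw [div_le_iff₀ (by positivity)]
    nlinarith [sq_nonneg (3 * x ^ 2 - 7)]
  simpa using h

lemma excessRisk_eq_integral_add (θ : ℝ) :
    excessRisk θ = ∫ x, (3 * (x + θ) ^ 2 - 2) / (1 + (x + θ) ^ 2) ^ 2 ∂(gaussianReal 0 1) := by
  have := gaussianReal_map_add_const (μ := 0) (v := 1) θ
  rw [zero_add] at this
  rw [excessRisk, ← this, integral_map (by fun_prop)
    continuous_excess_integrand.aestronglyMeasurable]

lemma continuous_excessRisk : Continuous excessRisk := by
  have : excessRisk = fun θ => ∫ x, (3 * (x + θ) ^ 2 - 2) / (1 + (x + θ) ^ 2) ^ 2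
      ∂(gaussianReal 0 1) := funext excessRisk_eq_integral_add
  rw [this]
  refine continuous_of_dominated (bound := fun _ => 2) (fun θ =>
      (continuous_excess_integrand.comp (continuous_add_const θ)).aestronglyMeasurable)
    (fun θ => Eventually.of_forall fun x => abs_excess_integrand_le (x + θ))
    (integrable_const _) (Eventually.of_forall fun x => ?_)
  exact continuous_excess_integrand.comp (by fun_prop : Continuous fun θ : ℝ => x + θ)

lemma tendsto_excess_integrand_cocompact :
    Tendsto (fun x : ℝ => (3 * x ^ 2 - 2) / (1 + x ^ 2) ^ 2) (cocompact ℝ) (𝓝 0) := by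
  have h1 : Tendsto (fun x : ℝ => 1 + x ^ 2) (cocompact ℝ) atTop := by
    refine tendsto_atTop_add_const_left _ _ ?_
    have := (tendsto_pow_atTop (α := ℝ) two_ne_zero).comp (tendsto_norm_cocompact_atTop (E := ℝ))
    refine this.congr fun x => by simp
  have h2 := h1.inv_tendsto_atTop
  have h3 : Tendsto (fun x : ℝ => 3 * (1 + x ^ 2)⁻¹ - 5 * ((1 + x ^ 2)⁻¹) ^ 2) (cocompact ℝ)
      (𝓝 (3 * 0 - 5 * 0 ^ 2)) := (h2.const_mul 3).sub ((h2.pow 2).const_mul 5)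
  rw [show (3 * 0 - 5 * 0 ^ 2 : ℝ) = 0 by norm_num] at h3
  refine h3.congr fun x => ?_
  have : (1 + x ^ 2) ≠ 0 := by positivity
  field_simp; ring

lemma tendsto_excessRisk_cocompact : Tendsto excessRisk (cocompact ℝ) (𝓝 0) := by
  have : excessRisk = fun θ => ∫ x, (3 * (x + θ) ^ 2 - 2) / (1 + (x + θ) ^ 2) ^ 2
      ∂(gaussianReal 0 1) := funext excessRisk_eq_integral_add
  rw [this]
  -- Dominated convergence along a filter requires it to be countably generated.
  have hcg : IsCountablyGenerated (cocompact ℝ) := by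
    rw [cocompact_eq_atBot_atTop]; infer_instance
  have h := tendsto_integral_filter_of_dominated_convergence (μ := gaussianReal 0 1)
    (l := cocompact ℝ) (fun _ => (2 : ℝ)) (f := fun _ => (0 : ℝ))
    (F := fun θ x => (3 * (x + θ) ^ 2 - 2) / (1 + (x + θ) ^ 2) ^ 2)
    (Eventually.of_forall fun θ =>
      (continuous_excess_integrand.comp (continuous_add_const θ)).aestronglyMeasurable)
    (Eventually.of_forall fun θ => Eventually.of_forall fun x => abs_excess_integrand_le (x + θ))
    (integrable_const _) (Eventually.of_forall fun x => tendsto_excess_integrand_cocompact.comp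
      (Homeomorph.addLeft x).isClosedEmbedding.tendsto_cocompact)
  simpa using h

/-- Positivity at one point makes the supremum exceed the limit 0 at infinity, so that it is
attained. Under N(5, 1) the set [-1, 1], where the integrand may be negative, has far less mass than
[4, 6], where it is at least 7/100. -/
lemma excessRisk_five_pos : 0 < excessRisk 5 := by
  have hpdf : ∀ x : ℝ, gaussianPDFReal 5 1 x = (√(2 * Real.pi))⁻¹ * Real.exp (-(x - 5) ^ 2 / 2) := by
    intro x; simp [gaussianPDFReal]
  set κ := (√(2 * Real.pi))⁻¹
  have hκ : 0 < κ := by positivity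
  have hreal : ∀ s : Set ℝ, (gaussianReal 5 1).real s = ∫ x in s, gaussianPDFReal 5 1 x := by
    intro s
    rw [measureReal_def, gaussianReal_apply_eq_integral _ one_ne_zero, ENNReal.toReal_ofReal]
    exact integral_nonneg fun x => gaussianPDFReal_nonneg _ _ _
  have hup : (gaussianReal 5 1).real (Set.Icc (-1) 1) ≤ 2 * (κ * Real.exp (-8)) := by
    have h1 : ∫ x in Set.Icc (-1 : ℝ) 1, gaussianPDFReal 5 1 x ≤
        ∫ x in Set.Icc (-1 : ℝ) 1, κ * Real.exp (-8) := by
      refine setIntegral_mono_on (integrable_gaussianPDFReal _ _).integrableOn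
        (integrableOn_const (by simp)) measurableSet_Icc fun x hx => ?_
      rw [hpdf]
      gcongr
      nlinarith [hx.1, hx.2]
    rw [hreal]
    refine h1.trans (le_of_eq ?_)
    simp only [setIntegral_const, Real.volume_real_Icc, smul_eq_mul]
    norm_num
  have hlow : 2 * (κ * Real.exp (-1 / 2)) ≤ (gaussianReal 5 1).real (Set.Icc 4 6) := by
    have h1 : ∫ x in Set.Icc (4 : ℝ) 6, κ * Real.exp (-1 / 2) ≤
        ∫ x in Set.Icc (4 : ℝ) 6, gaussianPDFReal 5 1 x := by
      refine setIntegral_mono_on (integrableOn_const (by simp)) (integrable_gaussianPDFReal _ _).integrableOn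
        measurableSet_Icc fun x hx => ?_
      rw [hpdf]
      gcongr
      nlinarith [hx.1, hx.2]
    rw [hreal]
    refine le_trans (le_of_eq ?_) h1
    simp only [setIntegral_const, Real.volume_real_Icc, smul_eq_mul]
    norm_num
  have hint : ∫ x, ((Set.Icc (4 : ℝ) 6).indicator (fun _ => (7 / 100 : ℝ)) x -
      (Set.Icc (-1 : ℝ) 1).indicator (fun _ => (2 : ℝ)) x) ∂(gaussianReal 5 1) ≤ excessRisk 5 := by
    refine integral_mono (((integrable_const _).indicator measurableSet_Icc).sub
      ((integrable_const _).indicator measurableSet_Icc)) (integrable_excess_integrand 5)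
      fun x => ?_
    simp only [Set.indicator_apply, Set.mem_Icc]
    split_ifs with h1 h2 h2
    · linarith [h1.1, h2.2]
    · rw [sub_zero, le_div_iff₀ (by positivity)]
      nlinarith [mul_nonneg (by nlinarith [h1.1] : 0 ≤ x ^ 2 - 16)
        (by nlinarith [h1.1, h1.2] : 0 ≤ 36 - x ^ 2)]
    · rw [zero_sub]
      exact (abs_le.1 (abs_excess_integrand_le x)).1
    · rw [sub_zero]
      have : 1 ≤ x ^ 2 := by
        by_contra hx
        exact h2 (abs_le.1 ((sq_le_one_iff_abs_le_one x).1 (not_le.1 hx).le))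
      exact div_nonneg (by linarith) (by positivity)
  rw [integral_sub ((integrable_const _).indicator measurableSet_Icc)
      ((integrable_const _).indicator measurableSet_Icc),
    integral_indicator_const _ measurableSet_Icc, integral_indicator_const _ measurableSet_Icc,
    smul_eq_mul, smul_eq_mul] at hint
  -- The comparison needs the ratio e^(15/2) to exceed 2/(7/100) < 40; e^(5/2) ≥ 7/2 already gives
  -- (7/2)³ > 42.
  have hexp : 40 * Real.exp (-8) < Real.exp (-1 / 2) := by
    have h1 : Real.exp (-1 / 2) = Real.exp (5 / 2) ^ 3 * Real.exp (-8) := by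
      rw [← Real.exp_nat_mul, ← Real.exp_add]; norm_num
    have h2 : (7 / 2 : ℝ) ≤ Real.exp (5 / 2) := by
      linarith [Real.add_one_le_exp (5 / 2 : ℝ)]
    have h3 : (7 / 2 : ℝ) ^ 3 ≤ Real.exp (5 / 2) ^ 3 := by gcongr
    rw [h1]
    nlinarith [Real.exp_pos (-8)]
  have := mul_lt_mul_of_pos_left hexp hκ
  have := mul_pos hκ (Real.exp_pos (-8))
  linarith

lemma exists_max_excessRisk : ∃ θ₀, ∀ θ, excessRisk θ ≤ excessRisk θ₀ := by
  obtain ⟨θ₀, h⟩ := continuous_excessRisk.exists_forall_ge' 5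
    ((tendsto_excessRisk_cocompact.eventually_lt_const excessRisk_five_pos).mono fun _ h => h.le)
  exact ⟨θ₀, h⟩

lemma exists_min_excessRisk : ∃ θ₀, ∀ θ, excessRisk θ₀ ≤ excessRisk θ := by
  have h0 : excessRisk 0 < 0 := by linarith [excessRisk_zero_mem.2]
  obtain ⟨θ₀, h⟩ := continuous_excessRisk.exists_forall_le' 0
    ((tendsto_excessRisk_cocompact.eventually_const_lt h0).mono fun _ h => h.le)
  exact ⟨θ₀, h⟩

/-- The risk of `X - X / (1 + X²)` under `X ~ N(θ, 1)`. -/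
lemma integral_sq_sub_shrinkage (θ : ℝ) :
    ∫ x, (θ - (x - x / (1 + x ^ 2))) ^ 2 ∂(gaussianReal θ 1) = 1 + excessRisk θ := by
  have hs := stein_gaussianReal_one (f := fun x => x / (1 + x ^ 2))
    (f' := fun x => (1 - x ^ 2) / (1 + x ^ 2) ^ 2) θ 1 ?_ ?_ abs_div_one_add_sq_le ?_
  · have hv : ∫ x, (x - θ) ^ 2 ∂(gaussianReal θ 1) = 1 := by
      have := variance_fun_id_gaussianReal (μ := θ) (v := 1)
      rw [variance_eq_integral (by fun_prop), integral_id_gaussianReal] at this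
      simpa using this
    have hc : Continuous fun x : ℝ => x / (1 + x ^ 2) := by
      have : ∀ x : ℝ, 1 + x ^ 2 ≠ 0 := fun x => by positivity
      fun_prop (disch := exact this _)
    have hl : MemLp (fun x : ℝ => x - θ) 2 (gaussianReal θ 1) :=
      (memLp_id_gaussianReal 2).sub (memLp_const _)
    have i1 : Integrable (fun x : ℝ => (x - θ) ^ 2) (gaussianReal θ 1) := hl.integrable_sq
    have i2 : Integrable (fun x : ℝ => (x - θ) * (x / (1 + x ^ 2))) (gaussianReal θ 1) :=
      Integrable.mul_bdd (c := 1) (hl.integrable one_le_two) hc.aestronglyMeasurable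
        (Eventually.of_forall abs_div_one_add_sq_le)
    have i3 : Integrable (fun x : ℝ => (x / (1 + x ^ 2)) ^ 2) (gaussianReal θ 1) := by
      refine Integrable.of_bound (hc.pow 2).aestronglyMeasurable 1 (Eventually.of_forall fun x => ?_)
      rw [norm_pow]
      exact pow_le_one₀ (norm_nonneg _) (abs_div_one_add_sq_le x)
    have i4 : Integrable (fun x : ℝ => (1 - x ^ 2) / (1 + x ^ 2) ^ 2) (gaussianReal θ 1) := by
      have := ((integrable_inv_one_add_sq_pow θ 2).const_mul 2).sub
        (integrable_inv_one_add_sq_pow θ 1)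
      refine this.congr (Eventually.of_forall fun x => ?_)
      have : (1 + x ^ 2) ≠ 0 := by positivity
      simp only [Pi.sub_apply]
      field_simp; ring
    have e : ∫ x, (θ - (x - x / (1 + x ^ 2))) ^ 2 ∂(gaussianReal θ 1) =
        ∫ x, ((x - θ) ^ 2 - 2 * ((x - θ) * (x / (1 + x ^ 2))) + (x / (1 + x ^ 2)) ^ 2)
          ∂(gaussianReal θ 1) := by
      congr 1; ext x; ring
    -- For f = x/(1 + x²), the excess integrand is f² - 2f': the cross term of the expanded square
    -- becomes 2 E f' by Stein's identity.
    have e' : excessRisk θ = ∫ x, ((x / (1 + x ^ 2)) ^ 2 - 2 * ((1 - x ^ 2) / (1 + x ^ 2) ^ 2))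
          ∂(gaussianReal θ 1) := by
      unfold excessRisk
      congr 1; ext x
      have : (1 + x ^ 2) ≠ 0 := by positivity
      field_simp; ring
    have i5 : Integrable (fun x : ℝ => (x - θ) ^ 2 - 2 * ((x - θ) * (x / (1 + x ^ 2))))
      (gaussianReal θ 1) := i1.sub (i2.const_mul 2)
    rw [e, e', integral_add i5 i3, integral_sub i1 (i2.const_mul 2),
      integral_sub i3 (i4.const_mul 2), integral_const_mul, integral_const_mul, hs, hv]
    ring
  · exact hasDerivAt_div_one_add_sq
  · have : ∀ x : ℝ, (1 + x ^ 2) ^ 2 ≠ 0 := fun x => by positivity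
    fun_prop (disch := exact this _)
  · intro x
    rw [abs_le, le_div_iff₀ (by positivity), div_le_iff₀ (by positivity)]
    constructor <;> nlinarith [sq_nonneg x, sq_nonneg (x ^ 2)]

end Stein

/-! ### The law of (V, W_h). -/

section Laws

variable {vC vE : ℝ≥0}

/-- The quadratic form is (σ_C² - σ_E²) x₀² + σ_E² (x₀ + x₁)². -/
lemma posSemidef_estimator_cov (h : vE ≤ vC) :
    (!![(vC : ℝ), (vE : ℝ); (vE : ℝ), (vE : ℝ)]).PosSemidef := by
  have h' : (vE : ℝ) ≤ vC := h
  refine Matrix.PosSemidef.of_dotProduct_mulVec_nonneg ?_ fun x => ?_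
  · ext i j; fin_cases i <;> fin_cases j <;> simp
  · simp [Matrix.mulVec, dotProduct, Fin.sum_univ_two]
    nlinarith [mul_nonneg vE.2 (sq_nonneg (x 0 + x 1)),
      mul_nonneg (sub_nonneg.2 h') (sq_nonneg (x 0)), vE.coe_nonneg]

/-- The quadratic form is σ_E² x₀² + (σ_C² - σ_E²)(x₀ - x₁)². -/
lemma posSemidef_limit_cov (h : vE ≤ vC) :
    (!![(vC : ℝ), -((vC : ℝ) - vE); -((vC : ℝ) - vE), (vC : ℝ) - vE]).PosSemidef := by
  have h' : (vE : ℝ) ≤ vC := h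
  refine Matrix.PosSemidef.of_dotProduct_mulVec_nonneg ?_ fun x => ?_
  · ext i j; fin_cases i <;> fin_cases j <;> simp
  · simp [Matrix.mulVec, dotProduct, Fin.sum_univ_two]
    nlinarith [mul_nonneg vE.2 (sq_nonneg (x 0)),
      mul_nonneg (sub_nonneg.2 h') (sq_nonneg (x 0 - x 1))]

/-- `(V, W_h)` is obtained from the estimation errors of the two estimators. -/
lemma map_estimator_errors_eq_lawVW (hlt : vE < vC) (h : ℝ) :
    (multivariateGaussian 0 !![(vC : ℝ), (vE : ℝ); (vE : ℝ), (vE : ℝ)]).map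
      (fun x : EuclideanSpace ℝ (Fin 2) => !₂[x 0, x 1 - x 0 + h]) = lawVW vC vE h := by
  have : IsProbabilityMeasure ((multivariateGaussian 0
      !![(vC : ℝ), (vE : ℝ); (vE : ℝ), (vE : ℝ)]).map
      (fun x : EuclideanSpace ℝ (Fin 2) => !₂[x 0, x 1 - x 0 + h])) :=
    Measure.isProbabilityMeasure_map (by fun_prop)
  refine Measure.ext_of_charFun (funext fun t => ?_)
  rw [lawVW, charFun_multivariateGaussian (posSemidef_limit_cov hlt.le), charFun_apply,
    integral_map (by fun_prop) (by fun_prop)]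
  -- The adjoint of the linear part sends t to (t₀ - t₁, t₁); the shift by h contributes a constant
  -- phase.
  have e : ∀ x : EuclideanSpace ℝ (Fin 2),
      Complex.exp ((inner ℝ !₂[x 0, x 1 - x 0 + h] t : ℝ) * Complex.I) =
      Complex.exp ((inner ℝ x !₂[t 0 - t 1, t 1] : ℝ) * Complex.I) *
        Complex.exp ((t 1 * h : ℝ) * Complex.I) := by
    intro x
    rw [← Complex.exp_add]
    congr 1
    simp [PiLp.inner_apply, Fin.sum_univ_two]
    ring
  simp_rw [e]
  rw [integral_mul_const, ← charFun_apply,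
    charFun_multivariateGaussian (posSemidef_estimator_cov hlt.le), ← Complex.exp_add]
  congr 1
  simp [PiLp.inner_apply, Fin.sum_univ_two, Matrix.mulVec, dotProduct]
  ring

/-- `V = Z - (W_h - h)` with `Z ~ N(0, σ_E²)` independent of `W_h`. -/
lemma lawVW_eq_map_prod (hlt : vE < vC) (h : ℝ) :
    lawVW vC vE h = ((gaussianReal 0 vE).prod (gaussianReal h (vC - vE))).map
      (fun q : ℝ × ℝ => !₂[q.1 - q.2 + h, q.2]) := by
  have : IsProbabilityMeasure (((gaussianReal 0 vE).prod (gaussianReal h (vC - vE))).map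
      (fun q : ℝ × ℝ => !₂[q.1 - q.2 + h, q.2])) :=
    Measure.isProbabilityMeasure_map (by fun_prop)
  refine Measure.ext_of_charFun (funext fun t => ?_)
  rw [lawVW, charFun_multivariateGaussian (posSemidef_limit_cov hlt.le), charFun_apply,
    integral_map (by fun_prop) (by fun_prop)]
  have e : ∀ q : ℝ × ℝ,
      Complex.exp ((inner ℝ !₂[q.1 - q.2 + h, q.2] t : ℝ) * Complex.I) =
      Complex.exp ((t 0 : ℝ) * q.1 * Complex.I) * Complex.exp ((t 1 - t 0 : ℝ) * q.2 * Complex.I) *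
        Complex.exp ((t 0 * h : ℝ) * Complex.I) := by
    intro x
    rw [← Complex.exp_add, ← Complex.exp_add]
    congr 1
    simp [PiLp.inner_apply, Fin.sum_univ_two]
    ring
  simp_rw [e]
  rw [integral_mul_const, integral_prod_mul
      (f := fun z : ℝ => Complex.exp ((t 0 : ℝ) * z * Complex.I))
      (g := fun w : ℝ => Complex.exp ((t 1 - t 0 : ℝ) * w * Complex.I)),
    ← charFun_apply_real, ← charFun_apply_real,
    charFun_gaussianReal, charFun_gaussianReal, ← Complex.exp_add, ← Complex.exp_add]
  congr 1
  have hd : (((vC - vE : ℝ≥0) : ℝ) : ℂ) = (vC : ℝ) - (vE : ℝ) := by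
    rw [NNReal.coe_sub hlt.le]; push_cast; rfl
  simp [PiLp.inner_apply, Fin.sum_univ_two, Matrix.mulVec, dotProduct, hd]
  ring

end Laws

/-! ### Moments of U_h, and the comparison of loss and gain. -/

section Risk

variable {vC vE : ℝ≥0}

lemma sq_add_ne_zero (hlt : vE < vC) (w : ℝ) : w ^ 2 + ((vC : ℝ) - vE) ≠ 0 := by
  have : (0 : ℝ) < (vC : ℝ) - vE := sub_pos.2 hlt
  positivity

lemma continuous_shrinkage (hlt : vE < vC) :
    Continuous fun w : ℝ => w * (((vC : ℝ) - vE) / (w ^ 2 + ((vC : ℝ) - vE))) := by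
  exact continuous_id.mul (continuous_const.div (by fun_prop) (sq_add_ne_zero hlt))

lemma continuous_shrinkage_error (hlt : vE < vC) (h : ℝ) :
    Continuous fun w : ℝ => h - (w - w * (((vC : ℝ) - vE) / (w ^ 2 + ((vC : ℝ) - vE)))) :=
  continuous_const.sub (continuous_id.sub (continuous_shrinkage hlt))

lemma continuous_U (hlt : vE < vC) : Continuous (U vC vE) := by
  have h0 : Continuous fun x : EuclideanSpace ℝ (Fin 2) => x 0 := by fun_prop
  have h1 : Continuous fun x : EuclideanSpace ℝ (Fin 2) => x 1 := by fun_prop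
  exact h0.add ((continuous_shrinkage hlt).comp h1)

lemma abs_shrinkage_le (hlt : vE < vC) (w : ℝ) :
    |w * (((vC : ℝ) - vE) / (w ^ 2 + ((vC : ℝ) - vE)))| ≤ 1 + ((vC : ℝ) - vE) := by
  have hd : (0 : ℝ) < (vC : ℝ) - vE := sub_pos.2 hlt
  set d := (vC : ℝ) - vE
  rw [← mul_div_assoc, abs_div, abs_mul, abs_of_pos hd,
    abs_of_pos (by positivity : 0 < w ^ 2 + d),
    div_le_iff₀ (by positivity)]
  have : |w| ≤ 1 + w ^ 2 := by nlinarith [sq_abs w, sq_nonneg (|w| - 1)]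
  nlinarith [mul_le_mul_of_nonneg_left this hd.le, sq_nonneg w, sq_nonneg d]

lemma memLp_shrinkage_error (hlt : vE < vC) (h : ℝ) :
    MemLp (fun w : ℝ => h - (w - w * (((vC : ℝ) - vE) / (w ^ 2 + ((vC : ℝ) - vE))))) 2
      (gaussianReal h (vC - vE)) := by
  refine (memLp_const h).sub ((memLp_id_gaussianReal 2).sub ?_)
  exact MemLp.of_bound (continuous_shrinkage hlt).aestronglyMeasurable _
    (Eventually.of_forall (abs_shrinkage_le hlt))

lemma U_eq (h z w : ℝ) : U vC vE !₂[z - w + h, w] =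
    z + (h - (w - w * (((vC : ℝ) - vE) / (w ^ 2 + ((vC : ℝ) - vE))))) := by
  simp only [U, Matrix.cons_val_zero, Matrix.cons_val_one]
  ring

lemma memLp_U_prod (hlt : vE < vC) (h : ℝ) :
    MemLp (fun q : ℝ × ℝ => q.1 +
      (h - (q.2 - q.2 * (((vC : ℝ) - vE) / (q.2 ^ 2 + ((vC : ℝ) - vE)))))) 2
      ((gaussianReal 0 vE).prod (gaussianReal h (vC - vE))) := by
  have h1 : MemLp (fun q : ℝ × ℝ => q.1) 2
      ((gaussianReal 0 vE).prod (gaussianReal h (vC - vE))) :=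
    (memLp_id_gaussianReal 2).comp_measurePreserving measurePreserving_fst
  exact h1.add ((memLp_shrinkage_error hlt h).comp_measurePreserving measurePreserving_snd)

lemma memLp_U (hlt : vE < vC) (h : ℝ) : MemLp (U vC vE) 2 (lawVW vC vE h) := by
  rw [lawVW_eq_map_prod hlt, memLp_map_measure_iff (continuous_U hlt).aestronglyMeasurable
    (by fun_prop)]
  exact (memLp_U_prod hlt h).ae_eq (Eventually.of_forall fun q => (U_eq h q.1 q.2).symm)

lemma integral_U_zero (hlt : vE < vC) : ∫ x, U vC vE x ∂(lawVW vC vE 0) = 0 := by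
  rw [lawVW_eq_map_prod hlt, integral_map (by fun_prop) (continuous_U hlt).aestronglyMeasurable]
  simp_rw [U_eq]
  have i1 : Integrable (fun q : ℝ × ℝ => q.1)
      ((gaussianReal 0 vE).prod (gaussianReal 0 (vC - vE))) :=
    ((memLp_id_gaussianReal 1).comp_measurePreserving measurePreserving_fst).integrable le_rfl
  have i2 : Integrable (fun q : ℝ × ℝ =>
      (0 - (q.2 - q.2 * (((vC : ℝ) - vE) / (q.2 ^ 2 + ((vC : ℝ) - vE))))))
      ((gaussianReal 0 vE).prod (gaussianReal 0 (vC - vE))) :=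
    ((memLp_shrinkage_error hlt 0).comp_measurePreserving measurePreserving_snd).integrable
      one_le_two
  rw [integral_add i1 i2, integral_fun_fst (fun z : ℝ => z), integral_fun_snd (fun w : ℝ =>
    (0 - (w - w * (((vC : ℝ) - vE) / (w ^ 2 + ((vC : ℝ) - vE))))))]
  simp only [probReal_univ, one_smul, integral_id_gaussianReal, zero_add]
  have hneg := gaussianReal_map_neg (μ := 0) (v := vC - vE)
  rw [neg_zero] at hneg
  -- For h = 0 the shrinkage error is odd in w and the law of w is symmetric.
  have key : ∫ w, (0 - (w - w * (((vC : ℝ) - vE) / (w ^ 2 + ((vC : ℝ) - vE)))))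
      ∂(gaussianReal 0 (vC - vE)) =
      - ∫ w, (0 - (w - w * (((vC : ℝ) - vE) / (w ^ 2 + ((vC : ℝ) - vE)))))
      ∂(gaussianReal 0 (vC - vE)) := by
    conv_lhs => rw [← hneg]
    rw [integral_map (by fun_prop) (continuous_shrinkage_error hlt 0).aestronglyMeasurable,
      ← integral_neg]
    congr 1; ext w
    rw [neg_sq]; ring
  linarith

/-- Z is centred and independent of W_h, so the cross term of the square vanishes. -/
lemma riskU_eq_add (hlt : vE < vC) (h : ℝ) : riskU vC vE h = vE +
    ∫ w, (h - (w - w * (((vC : ℝ) - vE) / (w ^ 2 + ((vC : ℝ) - vE))))) ^ 2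
      ∂(gaussianReal h (vC - vE)) := by
  have hm := memLp_shrinkage_error hlt h
  have hz : MemLp (fun z : ℝ => z) 2 (gaussianReal 0 vE) := memLp_id_gaussianReal 2
  have hc : Continuous fun x => U vC vE x ^ 2 := (continuous_U hlt).pow 2
  rw [riskU, lawVW_eq_map_prod hlt,
    integral_map (by fun_prop) hc.aestronglyMeasurable]
  simp_rw [U_eq]
  set f : ℝ → ℝ := fun w => h - (w - w * (((vC : ℝ) - vE) / (w ^ 2 + ((vC : ℝ) - vE)))) with hf
  have i1 : Integrable (fun q : ℝ × ℝ => q.1 ^ 2)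
      ((gaussianReal 0 vE).prod (gaussianReal h (vC - vE))) :=
    (hz.comp_measurePreserving measurePreserving_fst).integrable_sq
  have i2 : Integrable (fun q : ℝ × ℝ => f q.2 ^ 2)
      ((gaussianReal 0 vE).prod (gaussianReal h (vC - vE))) :=
    (hm.comp_measurePreserving measurePreserving_snd).integrable_sq
  have i3 : Integrable (fun q : ℝ × ℝ => q.1 * f q.2)
      ((gaussianReal 0 vE).prod (gaussianReal h (vC - vE))) :=
    (hz.integrable one_le_two).mul_prod (hm.integrable one_le_two)
  have i4 : Integrable (fun q : ℝ × ℝ => q.1 ^ 2 + 2 * (q.1 * f q.2))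
      ((gaussianReal 0 vE).prod (gaussianReal h (vC - vE))) := i1.add (i3.const_mul 2)
  have e : ∀ q : ℝ × ℝ, (q.1 + f q.2) ^ 2 = q.1 ^ 2 + 2 * (q.1 * f q.2) + f q.2 ^ 2 :=
    fun q => by ring
  have hv : ∫ z, z ^ 2 ∂(gaussianReal 0 vE) = vE := by
    have := variance_fun_id_gaussianReal (μ := 0) (v := vE)
    rw [variance_eq_integral (by fun_prop), integral_id_gaussianReal] at this
    simpa using this
  change ∫ q : ℝ × ℝ, (q.1 + f q.2) ^ 2 ∂_ = _
  simp_rw [e]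
  rw [integral_add i4 i2, integral_add i1 (i3.const_mul 2), integral_const_mul,
    integral_prod_mul (fun z : ℝ => z) f, integral_fun_fst (fun z : ℝ => z ^ 2),
    integral_fun_snd (fun w : ℝ => f w ^ 2), integral_id_gaussianReal, hv]
  simp [hf]

/-- Substituting w = √d x turns the shrinkage error into √d times that of X - X/(1 + X²) with mean
h/√d. -/
lemma riskU_eq (hlt : vE < vC) (h : ℝ) :
    riskU vC vE h = vC + ((vC : ℝ) - vE) * excessRisk (h / √((vC : ℝ) - vE)) := by
  have hd : (0 : ℝ) < (vC : ℝ) - vE := sub_pos.2 hlt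
  rw [riskU_eq_add hlt]
  have hs := Real.sq_sqrt hd.le
  have hs0 : 0 < √((vC : ℝ) - vE) := Real.sqrt_pos.2 hd
  have hmap := gaussianReal_map_const_mul (μ := h / √((vC : ℝ) - vE)) (v := 1)
    (√((vC : ℝ) - vE))
  rw [mul_div_cancel₀ _ hs0.ne', mul_one] at hmap
  have hv : NNReal.mk (√((vC : ℝ) - vE) ^ 2) (sq_nonneg _) = vC - vE :=
    NNReal.eq (by rw [NNReal.coe_sub hlt.le]; exact hs)
  rw [hv] at hmap
  have hc : Continuous fun w : ℝ => (h - (w - w * (((vC : ℝ) - vE) /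
      (w ^ 2 + ((vC : ℝ) - vE))))) ^ 2 := (continuous_shrinkage_error hlt h).pow 2
  have key : ∫ w, (h - (w - w * (((vC : ℝ) - vE) / (w ^ 2 + ((vC : ℝ) - vE))))) ^ 2
      ∂(gaussianReal h (vC - vE)) = ((vC : ℝ) - vE) * (1 + excessRisk (h / √((vC : ℝ) - vE))) := by
    rw [← integral_sq_sub_shrinkage, ← integral_const_mul, ← hmap,
      integral_map (by fun_prop) hc.aestronglyMeasurable]
    congr 1; ext x
    have hx : 1 + x ^ 2 ≠ 0 := by positivity
    generalize √((vC : ℝ) - vE) = s at *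
    rw [← hs]
    have hx' : (s * x) ^ 2 + s ^ 2 ≠ 0 := by positivity
    have e1 : s * x * (s ^ 2 / ((s * x) ^ 2 + s ^ 2)) = s * (x / (1 + x ^ 2)) := by
      field_simp; ring
    rw [e1]
    have e2 : h = s * (h / s) := by field_simp
    conv_lhs => rw [e2]
    ring
  rw [key]
  ring

lemma variance_U_zero_mem (hlt : vE < vC) :
    variance (U vC vE) (lawVW vC vE 0) ∈ Set.Ioo (vE : ℝ) (vC : ℝ) := by
  have hd : (0 : ℝ) < (vC : ℝ) - vE := sub_pos.2 hlt
  rw [variance_eq_sub (memLp_U hlt 0), integral_U_zero hlt]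
  have h1 : ∫ x, (U vC vE ^ 2) x ∂(lawVW vC vE 0) = riskU vC vE 0 := rfl
  rw [h1, riskU_eq hlt, zero_div]
  have h2 := excessRisk_zero_mem
  constructor <;> nlinarith [h2.1, h2.2]

lemma exists_max_loss_lt_max_gain (hlt : vE < vC) : ∃ loss gain : ℝ,
    IsGreatest (Set.range fun h : ℝ => riskU vC vE h - vC) loss ∧
    IsGreatest (Set.range fun h : ℝ => vC - riskU vC vE h) gain ∧ loss < gain := by
  have hd : (0 : ℝ) < (vC : ℝ) - vE := sub_pos.2 hlt
  have hs0 : √((vC : ℝ) - vE) ≠ 0 := (Real.sqrt_pos.2 hd).ne'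
  obtain ⟨θ₁, h₁⟩ := exists_max_excessRisk
  obtain ⟨θ₀, h₀⟩ := exists_min_excessRisk
  refine ⟨((vC : ℝ) - vE) * excessRisk θ₁, -(((vC : ℝ) - vE) * excessRisk θ₀),
    ⟨⟨θ₁ * √((vC : ℝ) - vE), ?_⟩, ?_⟩, ⟨⟨θ₀ * √((vC : ℝ) - vE), ?_⟩, ?_⟩, ?_⟩
  · simp only [riskU_eq hlt]
    rw [mul_div_cancel_right₀ _ hs0]; ring
  · rintro _ ⟨h, rfl⟩
    simp only [riskU_eq hlt]
    linarith [mul_le_mul_of_nonneg_left (h₁ (h / √((vC : ℝ) - vE))) hd.le]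
  · simp only [riskU_eq hlt]
    rw [mul_div_cancel_right₀ _ hs0]; ring
  · rintro _ ⟨h, rfl⟩
    simp only [riskU_eq hlt]
    linarith [mul_le_mul_of_nonneg_left (h₀ (h / √((vC : ℝ) - vE))) hd.le]
  · rw [← mul_neg]
    refine mul_lt_mul_of_pos_left ?_ hd
    -- k(θ₁) ≤ 9/20 < 1/2 ≤ -k(0) ≤ -k(θ₀).
    linarith [excessRisk_le θ₁, h₀ 0, excessRisk_zero_mem.2]

end Risk

/-! ### The explicit minimizing weight. -/

section Weight

/-- The estimated MSE is a strictly convex quadratic if the estimated second moment of the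
difference of the estimators is positive, and then its minimizer is explicit. -/
lemma eq_div_of_minimizes_empMSE {bC bE VC VE cv p : ℝ}
    (hQ : 0 < (bE - bC) ^ 2 + VE + VC - 2 * cv)
    (hp : (∃ q : ℝ, ∀ r : ℝ, empMSE bC bE VC VE cv q ≤ empMSE bC bE VC VE cv r) →
      ∀ r : ℝ, empMSE bC bE VC VE cv p ≤ empMSE bC bE VC VE cv r) :
    p = (VC - cv) / ((bE - bC) ^ 2 + VE + VC - 2 * cv) := by
  set Q := (bE - bC) ^ 2 + VE + VC - 2 * cv with hQdef
  set q := (VC - cv) / Q with hq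
  have hqQ : q * Q = VC - cv := div_mul_cancel₀ _ hQ.ne'
  -- Completing the square makes q a minimizer, which activates `hp`; comparing p with q then forces
  -- p = q.
  have key : ∀ r, empMSE bC bE VC VE cv r = empMSE bC bE VC VE cv q + Q * (r - q) ^ 2 := by
    intro r
    have h1 : ∀ t, empMSE bC bE VC VE cv t = Q * t ^ 2 - 2 * (q * Q) * t + VC := by
      intro t
      rw [hqQ, hQdef]
      unfold empMSE
      ring
    rw [h1, h1]
    ring
  have h2 := hp ⟨q, fun r => by rw [key r]; nlinarith [mul_nonneg hQ.le (sq_nonneg (r - q))]⟩ q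
  rw [key p] at h2
  have h3 : (p - q) ^ 2 = 0 := by
    refine le_antisymm ?_ (sq_nonneg _)
    by_contra h
    have := mul_pos hQ (not_le.1 h)
    linarith
  exact sub_eq_zero.1 (pow_eq_zero_iff two_ne_zero |>.1 h3)

end Weight

/-! ### Limit laws of the combination. -/

section Limit

variable {Ω : ℕ → Type*} {m : ∀ n, MeasurableSpace (Ω n)} {P : ∀ n, Measure (Ω n)}
  [∀ n, IsProbabilityMeasure (P n)] {bC bE VC VE cv p : ∀ n, Ω n → ℝ} {β₀ βE : ℕ → ℝ}
  {vC vE : ℝ≥0}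

lemma aemeasurable_scaled_combination (hs : Setup P bC bE VC VE cv β₀ βE vC vE)
    (hp : ∀ n, AEMeasurable (p n) (P n)) (n : ℕ) :
    AEMeasurable (fun ω => √(n : ℝ) * (combination (bC n ω) (bE n ω) (p n ω) - β₀ n)) (P n) := by
  -- For n = 0 the statistic is constantly 0. Otherwise measurability of bC and bE is recovered from
  -- that of the scaled errors by dividing by √n.
  rcases Nat.eq_zero_or_pos n with rfl | hn
  · simp
  have hs0 : √(n : ℝ) ≠ 0 := (Real.sqrt_pos.2 (Nat.cast_pos.2 hn)).ne'
  have h := hs.asymptotically_normal.forall_aemeasurable n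
  have h0 : AEMeasurable (fun ω => √(n : ℝ) * (bC n ω - β₀ n)) (P n) :=
    (by fun_prop : Measurable fun x : EuclideanSpace ℝ (Fin 2) => x 0).comp_aemeasurable h
  have h1 : AEMeasurable (fun ω => √(n : ℝ) * (bE n ω - βE n)) (P n) :=
    (by fun_prop : Measurable fun x : EuclideanSpace ℝ (Fin 2) => x 1).comp_aemeasurable h
  have hC : AEMeasurable (bC n) (P n) := by
    refine ((h0.const_mul (√(n : ℝ))⁻¹).add_const (β₀ n)).congr (Eventually.of_forall fun ω => ?_)
    simp only
    field_simp
    ring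
  have hE : AEMeasurable (bE n) (P n) := by
    refine ((h1.const_mul (√(n : ℝ))⁻¹).add_const (βE n)).congr (Eventually.of_forall fun ω => ?_)
    simp only
    field_simp
    ring
  have := hp n
  unfold combination
  fun_prop

lemma MSECombination.Setup.tendsto_measure_variances (hs : Setup P bC bE VC VE cv β₀ βE vC vE)
    (ε : ℝ) (hε : 0 < ε) :
    Tendsto (fun n => P n {ω | ε ≤ ‖((√(n : ℝ))⁻¹, (n : ℝ) * VC n ω, (n : ℝ) * VE n ω,
      (n : ℝ) * cv n ω) - (0, (vC : ℝ), (vE : ℝ), (vE : ℝ))‖}) atTop (𝓝 0) := by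
  have he : ∀ ε : ℝ, 0 < ε →
      Tendsto (fun n => P n {ω | ε ≤ ‖(√(n : ℝ))⁻¹ - 0‖}) atTop (𝓝 0) := by
    intro ε hε
    have h1 : Tendsto (fun n : ℕ => (√(n : ℝ))⁻¹) atTop (𝓝 0) :=
      (Real.tendsto_sqrt_atTop.comp tendsto_natCast_atTop_atTop).inv_tendsto_atTop
    refine tendsto_const_nhds.congr' ?_
    filter_upwards [h1.norm.eventually_lt_const (by simpa using hε)] with n hn
    have : {ω : Ω n | ε ≤ ‖(√(n : ℝ))⁻¹ - 0‖} = ∅ := by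
      ext ω
      simpa using hn
    rw [this, measure_empty]
  have h1 := tendsto_measure_norm_prodMk (X := fun n ω => (n : ℝ) * VE n ω)
    (Y := fun n ω => (n : ℝ) * cv n ω) hs.consistent_VE hs.consistent_cv
  have h2 := tendsto_measure_norm_prodMk (X := fun n ω => (n : ℝ) * VC n ω) hs.consistent_VC h1
  exact tendsto_measure_norm_prodMk (X := fun (n : ℕ) (_ : Ω n) => (√(n : ℝ))⁻¹) he h2 ε hε

/-- A statistic which, with probability tending to one, is a continuous function of the scaled
estimation errors, of `1 / √n` and of the scaled variance estimators converges in distribution. -/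
lemma MSECombination.Setup.tendstoInDistribution (hs : Setup P bC bE VC VE cv β₀ βE vC vE)
    {R : ∀ n, Ω n → ℝ} (hR : ∀ n, AEMeasurable (R n) (P n))
    {g H : EuclideanSpace ℝ (Fin 2) × (ℝ × ℝ × ℝ × ℝ) → ℝ} (hg : Continuous g) (hH : Continuous H)
    (hpos : ∀ x, 0 < H (x, (0, (vC : ℝ), (vE : ℝ), (vE : ℝ))))
    (h : ∀ n : ℕ, 0 < n → ∀ᵐ ω ∂(P n),
      0 < H (!₂[√(n : ℝ) * (bC n ω - β₀ n), √(n : ℝ) * (bE n ω - βE n)],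
        ((√(n : ℝ))⁻¹, (n : ℝ) * VC n ω, (n : ℝ) * VE n ω, (n : ℝ) * cv n ω)) →
      R n ω = g (!₂[√(n : ℝ) * (bC n ω - β₀ n), √(n : ℝ) * (bE n ω - βE n)],
        ((√(n : ℝ))⁻¹, (n : ℝ) * VC n ω, (n : ℝ) * VE n ω, (n : ℝ) * cv n ω))) :
    TendstoInDistribution R atTop (fun x => g (x, (0, (vC : ℝ), (vE : ℝ), (vE : ℝ)))) P
      (multivariateGaussian 0 !![(vC : ℝ), (vE : ℝ); (vE : ℝ), (vE : ℝ)]) := by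
  have hVC := hs.aemeasurable_VC
  have hVE := hs.aemeasurable_VE
  have hcv := hs.aemeasurable_cv
  have hYm : ∀ n : ℕ, AEMeasurable (fun ω =>
      ((√(n : ℝ))⁻¹, (n : ℝ) * VC n ω, (n : ℝ) * VE n ω, (n : ℝ) * cv n ω)) (P n) := by
    intro n
    have := hVC n
    have := hVE n
    have := hcv n
    fun_prop
  have hgX := hs.asymptotically_normal.slutsky hYm hs.tendsto_measure_variances hg
  have hHX := hs.asymptotically_normal.slutsky hYm hs.tendsto_measure_variances hH
  -- The exceptional event is H ≤ 0, a closed condition that the limit avoids.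
  have hB := hHX.tendsto_measure_closed (F := Set.Iic 0) isClosed_Iic fun x => not_le.2 (hpos x)
  refine hgX.of_eventually_eq hR hB ?_
  filter_upwards [eventually_gt_atTop 0] with n hn
  filter_upwards [h n hn] with ω hω hB
  exact hω (not_le.1 hB)

/-- The limit law of the combination of estimators under local alternatives. -/
lemma tendstoInDistribution_combination_local (hs : Setup P bC bE VC VE cv β₀ βE vC vE)
    (hp : IsMSEWeight P bC bE VC VE cv p) (h : ℝ)
    (hβ : ∀ n : ℕ, 0 < n → βE n = β₀ n + h / √(n : ℝ)) :
    TendstoInDistribution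
      (fun (n : ℕ) ω => √(n : ℝ) * (combination (bC n ω) (bE n ω) (p n ω) - β₀ n))
      atTop (U vC vE) P (lawVW vC vE h) := by
  have hlt := hs.variance_lt
  have hd : (0 : ℝ) < (vC : ℝ) - vE := sub_pos.2 hlt
  have hden : ∀ z : EuclideanSpace ℝ (Fin 2) × (ℝ × ℝ × ℝ × ℝ), (z.1 1 - z.1 0 + h) ^ 2 +
      max (z.2.2.1 + z.2.2.2.1 - 2 * z.2.2.2.2) (((vC : ℝ) - vE) / 2) ≠ 0 := fun z => by
    have := lt_max_of_lt_right (b := z.2.2.1 + z.2.2.2.1 - 2 * z.2.2.2.2) (half_pos hd)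
    positivity
  -- The coordinates of z.2 are 1/√n, n VC, n VE and n cov. The estimated variance of the difference
  -- tends to d > d/2, so the maximum with d/2 is harmless in the limit; H > 0 says that it is
  -- inactive.
  have key := hs.tendstoInDistribution (aemeasurable_scaled_combination hs hp.aemeasurable)
    (g := fun z => z.1 0 + (z.1 1 - z.1 0 + h) * ((z.2.2.1 - z.2.2.2.2) /
      ((z.1 1 - z.1 0 + h) ^ 2 +
        max (z.2.2.1 + z.2.2.2.1 - 2 * z.2.2.2.2) (((vC : ℝ) - vE) / 2))))
    (H := fun z => z.2.2.1 + z.2.2.2.1 - 2 * z.2.2.2.2 - ((vC : ℝ) - vE) / 2) ?_ (by fun_prop) ?_ ?_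
  · refine key.of_map_eq (continuous_U hlt).measurable.aemeasurable ?_
    rw [← map_estimator_errors_eq_lawVW hlt, Measure.map_map (continuous_U hlt).measurable
      (by fun_prop)]
    congr 1
    ext x
    have e : max ((vC : ℝ) + vE - 2 * vE) (((vC : ℝ) - vE) / 2) = (vC : ℝ) - vE := by
      rw [max_eq_left (by linarith)]
      ring
    simp only [e, U, Function.comp_apply, Matrix.cons_val_zero, Matrix.cons_val_one]
  · have h1 : Continuous fun z : EuclideanSpace ℝ (Fin 2) × (ℝ × ℝ × ℝ × ℝ) =>
        (z.1 1 - z.1 0 + h) ^ 2 +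
          max (z.2.2.1 + z.2.2.2.1 - 2 * z.2.2.2.2) (((vC : ℝ) - vE) / 2) := by fun_prop
    have h2 : Continuous fun z : EuclideanSpace ℝ (Fin 2) × (ℝ × ℝ × ℝ × ℝ) =>
        z.2.2.1 - z.2.2.2.2 := by fun_prop
    have h3 : Continuous fun z : EuclideanSpace ℝ (Fin 2) × (ℝ × ℝ × ℝ × ℝ) =>
        z.1 1 - z.1 0 + h := by fun_prop
    have h4 : Continuous fun z : EuclideanSpace ℝ (Fin 2) × (ℝ × ℝ × ℝ × ℝ) => z.1 0 := by
      fun_prop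
    exact h4.add (h3.mul (h2.div h1 hden))
  · intro x
    simp only
    linarith
  · intro n hn
    filter_upwards [hp.minimizes n] with ω hω hpos
    have hn' : (0 : ℝ) < n := Nat.cast_pos.2 hn
    have hs0 : 0 < √(n : ℝ) := Real.sqrt_pos.2 hn'
    have hsq : √(n : ℝ) ^ 2 = n := Real.sq_sqrt hn'.le
    simp only [Matrix.cons_val_zero, Matrix.cons_val_one] at hpos ⊢
    have hw : √(n : ℝ) * (bE n ω - βE n) - √(n : ℝ) * (bC n ω - β₀ n) + h =
        √(n : ℝ) * (bE n ω - bC n ω) := by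
      rw [hβ n hn]
      field_simp
      ring
    rw [hw, max_eq_left (by linarith)]
    have hQ : 0 < (bE n ω - bC n ω) ^ 2 + VE n ω + VC n ω - 2 * cv n ω := by
      have : 0 < (n : ℝ) * (VE n ω + VC n ω - 2 * cv n ω) := by linarith
      have := (pos_iff_pos_of_mul_pos this).1 hn'
      nlinarith [sq_nonneg (bE n ω - bC n ω)]
    have hp' := eq_div_of_minimizes_empMSE hQ hω
    have e : ((n : ℝ) * VC n ω - n * cv n ω) / ((√(n : ℝ) * (bE n ω - bC n ω)) ^ 2 +
        ((n : ℝ) * VC n ω + n * VE n ω - 2 * (n * cv n ω))) = p n ω := by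
      rw [hp', mul_pow, hsq, ← mul_div_mul_left (VC n ω - cv n ω) _ hn'.ne']
      congr 1 <;> ring
    rw [e]
    unfold combination
    ring

/-- The limit law of the combination of estimators if the efficient estimator is inconsistent. -/
lemma tendstoInDistribution_combination_fixed (hs : Setup P bC bE VC VE cv β₀ βE vC vE)
    (hp : IsMSEWeight P bC bE VC VE cv p) {b₀ b₁ : ℝ} (hb : b₀ ≠ b₁)
    (hβ₀ : ∀ n, β₀ n = b₀) (hβE : ∀ n, βE n = b₁) :
    TendstoInDistribution
      (fun (n : ℕ) ω => √(n : ℝ) * (combination (bC n ω) (bE n ω) (p n ω) - β₀ n))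
      atTop (id : ℝ → ℝ) P (gaussianReal 0 vC) := by
  have hlt := hs.variance_lt
  have hΔ : 0 < (b₁ - b₀) ^ 2 / 4 := by
    have := sub_ne_zero.2 hb.symm
    positivity
  -- Here b₁ - b₀ + z.2.1 * (z.1 1 - z.1 0) is bE - bC, and the quotient is √n times the weight. At
  -- 1/√n = 0 its numerator vanishes, leaving z.1 0, while the denominator (b₁ - b₀)² stays above
  -- the cut-off.
  have key := hs.tendstoInDistribution (aemeasurable_scaled_combination hs hp.aemeasurable)
    (g := fun z => z.1 0 + (b₁ - b₀ + z.2.1 * (z.1 1 - z.1 0)) *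
      ((z.2.1 * (z.2.2.1 - z.2.2.2.2)) / max ((b₁ - b₀ + z.2.1 * (z.1 1 - z.1 0)) ^ 2 +
        (z.2.2.1 + z.2.2.2.1 - 2 * z.2.2.2.2) * z.2.1 ^ 2) ((b₁ - b₀) ^ 2 / 4)))
    (H := fun z => (b₁ - b₀ + z.2.1 * (z.1 1 - z.1 0)) ^ 2 +
        (z.2.2.1 + z.2.2.2.1 - 2 * z.2.2.2.2) * z.2.1 ^ 2 - (b₁ - b₀) ^ 2 / 4) ?_ (by fun_prop) ?_ ?_
  · refine key.of_map_eq aemeasurable_id ?_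
    rw [Measure.map_id]
    have := (measurePreserving_eval_multivariateGaussian (μ := 0)
      (posSemidef_estimator_cov hlt.le) (i := 0)).map_eq
    simpa using this
  · have h1 : Continuous fun z : EuclideanSpace ℝ (Fin 2) × (ℝ × ℝ × ℝ × ℝ) =>
        max ((b₁ - b₀ + z.2.1 * (z.1 1 - z.1 0)) ^ 2 +
          (z.2.2.1 + z.2.2.2.1 - 2 * z.2.2.2.2) * z.2.1 ^ 2) ((b₁ - b₀) ^ 2 / 4) := by fun_prop
    have h2 : Continuous fun z : EuclideanSpace ℝ (Fin 2) × (ℝ × ℝ × ℝ × ℝ) =>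
        z.2.1 * (z.2.2.1 - z.2.2.2.2) := by fun_prop
    have h3 : Continuous fun z : EuclideanSpace ℝ (Fin 2) × (ℝ × ℝ × ℝ × ℝ) =>
        b₁ - b₀ + z.2.1 * (z.1 1 - z.1 0) := by fun_prop
    have h4 : Continuous fun z : EuclideanSpace ℝ (Fin 2) × (ℝ × ℝ × ℝ × ℝ) => z.1 0 := by
      fun_prop
    exact h4.add (h3.mul (h2.div h1 fun z => (lt_max_of_lt_right hΔ).ne'))
  · intro x
    simp only
    nlinarith
  · intro n hn
    filter_upwards [hp.minimizes n] with ω hω hpos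
    have hn' : (0 : ℝ) < n := Nat.cast_pos.2 hn
    have hs0 : 0 < √(n : ℝ) := Real.sqrt_pos.2 hn'
    have hsq : √(n : ℝ) ^ 2 = n := Real.sq_sqrt hn'.le
    simp only [Matrix.cons_val_zero, Matrix.cons_val_one, hβ₀, hβE] at hpos ⊢
    have hD : b₁ - b₀ + (√(n : ℝ))⁻¹ * (√(n : ℝ) * (bE n ω - b₁) - √(n : ℝ) * (bC n ω - b₀)) =
        bE n ω - bC n ω := by
      field_simp
      ring
    have hq : ((n : ℝ) * VC n ω + n * VE n ω - 2 * (n * cv n ω)) * (√(n : ℝ))⁻¹ ^ 2 =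
        VE n ω + VC n ω - 2 * cv n ω := by
      rw [inv_pow, hsq]
      field_simp
      ring
    rw [hD, hq] at hpos ⊢
    have hQ : 0 < (bE n ω - bC n ω) ^ 2 + VE n ω + VC n ω - 2 * cv n ω := by linarith
    have hp' := eq_div_of_minimizes_empMSE hQ hω
    have e : (√(n : ℝ))⁻¹ * ((n : ℝ) * VC n ω - n * cv n ω) /
        ((bE n ω - bC n ω) ^ 2 + (VE n ω + VC n ω - 2 * cv n ω)) = √(n : ℝ) * p n ω := by
      have e1 : (√(n : ℝ))⁻¹ * ((n : ℝ) * VC n ω - n * cv n ω) =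
          √(n : ℝ) * (VC n ω - cv n ω) := by
        nth_rewrite 2 3 [← hsq]
        field_simp
      rw [hp', e1, mul_div_assoc]
      congr 2
      ring
    rw [max_eq_left (by linarith), e]
    unfold combination
    ring

end Limit

theorem theorem1 {Ω : ℕ → Type*} {m : ∀ n, MeasurableSpace (Ω n)}
    (P : ∀ n, Measure (Ω n)) [∀ n, IsProbabilityMeasure (P n)]
    (bC bE VC VE cv p : ∀ n, Ω n → ℝ) (β₀ βE : ℕ → ℝ) (vC vE : ℝ≥0)
    (hsetup : Setup P bC bE VC VE cv β₀ βE vC vE)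
    (hp : IsMSEWeight P bC bE VC VE cv p) :
    -- Point 1: fixed distinct limits
    ((∀ b₀ b₁ : ℝ, b₀ ≠ b₁ → (∀ n, β₀ n = b₀) → (∀ n, βE n = b₁) →
      TendstoInDistribution
        (fun (n : ℕ) ω => √(n : ℝ) * (combination (bC n ω) (bE n ω) (p n ω) - β₀ n))
        atTop (id : ℝ → ℝ) P (gaussianReal 0 vC))) ∧
    -- Point 2: equal limits
    (((∀ n, βE n = β₀ n) →
      TendstoInDistribution
        (fun (n : ℕ) ω => √(n : ℝ) * (combination (bC n ω) (bE n ω) (p n ω) - β₀ n))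
        atTop (U vC vE) P (lawVW vC vE 0)) ∧
      MemLp (U vC vE) 2 (lawVW vC vE 0) ∧
      ∫ x, U vC vE x ∂(lawVW vC vE 0) = 0 ∧
      variance (U vC vE) (lawVW vC vE 0) ∈ Set.Ioo (vE : ℝ) (vC : ℝ)) ∧
    -- Point 3: local alternatives
    ((∀ h : ℝ, (∀ n : ℕ, 0 < n → βE n = β₀ n + h / √(n : ℝ)) →
      TendstoInDistribution
        (fun (n : ℕ) ω => √(n : ℝ) * (combination (bC n ω) (bE n ω) (p n ω) - β₀ n))
        atTop (U vC vE) P (lawVW vC vE h)) ∧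
      (∀ h : ℝ, MemLp (U vC vE) 2 (lawVW vC vE h)) ∧
      ∃ loss gain : ℝ,
        IsGreatest (Set.range fun h : ℝ => riskU vC vE h - vC) loss ∧
        IsGreatest (Set.range fun h : ℝ => vC - riskU vC vE h) gain ∧
        loss < gain) := by
  have hlt := hsetup.variance_lt
  refine ⟨fun b₀ b₁ hb h₀ h₁ => tendstoInDistribution_combination_fixed hsetup hp hb h₀ h₁,
    ⟨fun hβ => tendstoInDistribution_combination_local hsetup hp 0 fun n _ => ?_, memLp_U hlt 0,
      integral_U_zero hlt, variance_U_zero_mem hlt⟩,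
    tendstoInDistribution_combination_local hsetup hp, memLp_U hlt,
    exists_max_loss_lt_max_gain hlt⟩
  rw [hβ n, zero_div, add_zero]
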